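/- Identify the space of monic complex polynomials of degree $n$ with $\mathbb C^n$ by $a=(a_0,\dots,a_{n-1})\mapsto g_a(x)=x^n+\sum_{k=0}^{n-1}a_kx^k$. Write $g^{\circ r}$ for the $r$-fold composition of $g$ with itself. Let $\ell\ge 1$ and $r_1,\dots,r_\ell\ge 1$ be integers, and let $Z=Z(n,\ell;r_1,\dots,r_\ell)\subset\mathbb C^n$ be the set of all $g$ such that, for each $i$, the polynomial $g^{\circ r_i}(x)-x$ has no multiple roots. Let $g\in Z$, and let $\beta_1,\dots,\beta_\ell\in\mathbb C$ be periodic points of $z\mapsto g(z)$ of exact periods $r_1,\dots,r_\ell$ that lie in pairwise distinct orbits. By the implicit function theorem each $\beta_i$ extends uniquely to a holomorphic function $h\mapsto\beta_i(h)$ of the coefficients of the polynomial $h$ near $g$ with $h^{\circ r_i}(\beta_i(h))=\beta_i(h)$; let $\mathrm{Mult}_{\beta_i,r_i}(h)=(h^{\circ r_i})'(\beta_i(h))$ be the corresponding locally defined multiplier function, and let $\mathrm{grad}(\mathrm{Mult}_{\beta_i,r_i})_{|g}\in\mathbb C^n$ be the vector of its partial derivatives at $g$ with respect to the coefficients. Let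 $Z^0=Z^0(n,\ell;r_1,\dots,r_\ell)$ be the set of all $g\in Z$ such that for every such choice of $\beta_1,\dots,\beta_\ell$ the $\ell$ gradients $\mathrm{grad}(\mathrm{Mult}_{\beta_i,r_i})_{|g}$ are linearly independent in $\mathbb C^n$. Suppose that $n\ge 3$ and $\sum_{i=1}^\ell r_i\le n$, and that $\sum_{i=1}^\ell r_i<n$ if $r_j=1$ for some $j$. Then $Z^0$ is a Zariski-open subset of $Z$ and of $\mathbb C^n$, it is dense in $Z$ (in the Zariski topology and in the complex topology), and it contains $x^n$. Moreover, a polynomial $g\in Z$ lies in $Z^0$ if and only if for every choice of $\beta_1,\dots,\beta_\ell$ as above the map $(\mathrm{Mult}_{\beta_i,r_i})_{i=1}^{\ell}$ to $\mathbb C^\ell$, which is defined near $g$, is holomorphic at $g$ and has (maximal) rank $\ell$ there; so these maps have rank $\ell$ on the nonempty Zariski-open set $Z^0$. -/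

import Mathlib

open Polynomial Filter Topology

/-- The affine space of monic complex polynomials of degree `n` is identified with `Fin n → ℂ`:
the vector `a` is the polynomial `x ^ n + a_{n-1} x ^ (n-1) + … + a_0`. -/
noncomputable def monicPoly {n : ℕ} (a : Fin n → ℂ) : ℂ[X] :=
  X ^ n + ∑ k : Fin n, C (a k) * X ^ (k : ℕ)

/-- The `r`-fold composition `g ∘ ⋯ ∘ g` of a polynomial with itself. -/
noncomputable def iterPoly (g : ℂ[X]) (r : ℕ) : ℂ[X] := (fun p : ℂ[X] => g.comp p)^[r] X

/-- `p` has no multiple roots (false for `p = 0`). -/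
def NoMultipleRoots (p : ℂ[X]) : Prop := ∀ z : ℂ, p.eval z = 0 → p.derivative.eval z ≠ 0

/-- The set `Z_{n,r}` of all `g` such that `g^{∘ r}(x) - x` has no multiple roots. -/
def Znr (n r : ℕ) : Set (Fin n → ℂ) :=
  {a | NoMultipleRoots (iterPoly (monicPoly a) r - X)}

/-- `Z(n, ℓ; r_1, …, r_ℓ)`, the intersection of the sets `Z_{n,r_i}`. -/
def Zset (n : ℕ) {ℓ : ℕ} (r : Fin ℓ → ℕ) : Set (Fin n → ℂ) := ⋂ i, Znr n (r i)

/-- The zero set in `ℂ ^ n` of a set of polynomials in `n` variables. -/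
def zeroSet {n : ℕ} (I : Set (MvPolynomial (Fin n) ℂ)) : Set (Fin n → ℂ) :=
  {a | ∀ f ∈ I, MvPolynomial.eval a f = 0}

/-- The Zariski topology on `ℂ ^ n`: the closed sets are the zero sets of polynomials. -/
def zariskiTopology (n : ℕ) : TopologicalSpace (Fin n → ℂ) :=
  TopologicalSpace.ofClosed {S | ∃ I : Set (MvPolynomial (Fin n) ℂ), S = zeroSet I}
    ⟨{1}, by ext a; simp [zeroSet]⟩
    (by
      intro A hA
      refine ⟨{f | ∃ I, zeroSet I ∈ A ∧ f ∈ I}, ?_⟩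
      ext a
      simp only [Set.mem_sInter, zeroSet, Set.mem_ofPred_eq]
      constructor
      · rintro h f ⟨I, hI, hf⟩
        exact h _ hI f hf
      · intro h S hS
        obtain ⟨I, rfl⟩ := hA hS
        exact fun f hf => h f ⟨I, hS, hf⟩)
    (by
      rintro _ ⟨I, rfl⟩ _ ⟨J, rfl⟩
      refine ⟨{h | ∃ f ∈ I, ∃ g ∈ J, h = f * g}, ?_⟩
      ext a
      simp only [Set.mem_union, zeroSet, Set.mem_ofPred_eq]
      constructor
      · rintro (h | h) _ ⟨f, hf, g, hg, rfl⟩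
        · simp [h f hf]
        · simp [h g hg]
      · intro h
        by_contra! hc
        obtain ⟨⟨f, hf, hf0⟩, ⟨g, hg, hg0⟩⟩ := hc
        have := h _ ⟨f, hf, g, hg, rfl⟩
        rw [map_mul] at this
        exact (mul_ne_zero hf0 hg0) this)

/-- The orbit of `β` under `z ↦ g z`. -/
def orbitSet (g : ℂ[X]) (β : ℂ) : Set ℂ := Set.range fun m : ℕ => (fun z => g.eval z)^[m] β

/-- `β_1, …, β_ℓ` are periodic points of `z ↦ g z` of exact periods `r_1, …, r_ℓ`, which lie in
pairwise distinct orbits. -/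
def IsPeriodicTuple (g : ℂ[X]) {ℓ : ℕ} (r : Fin ℓ → ℕ) (β : Fin ℓ → ℂ) : Prop :=
  (∀ i, 0 < r i ∧ Function.minimalPeriod (fun z => g.eval z) (β i) = r i) ∧
    Pairwise fun i j => orbitSet g (β i) ≠ orbitSet g (β j)

/-- `B` is a holomorphic function near `a` with `B a = β` such that for all `b` near `a` the number
`B b` is a root of `g^{∘ r}(x) - x`, where `g` is the polynomial with coefficients `b`. -/
def IsPeriodicBranch {n : ℕ} (r : ℕ) (a : Fin n → ℂ) (β : ℂ) (B : (Fin n → ℂ) → ℂ) : Prop :=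
  AnalyticAt ℂ B a ∧ B a = β ∧ ∀ᶠ b in 𝓝 a, (iterPoly (monicPoly b) r).eval (B b) = B b

/-- The point `β` (a root of `g^{∘ r}(x) - x` for the polynomial `g` with coefficients `a`) viewed
as a holomorphic function of the coefficients near `a`. Its germ at `a` exists and is unique for
`a` in `Z_{n,r}`: see `periodicBranch_spec` and `IsPeriodicBranch.eventuallyEq`. -/
noncomputable def periodicBranch {n : ℕ} (r : ℕ) (a : Fin n → ℂ) (β : ℂ) : (Fin n → ℂ) → ℂ :=
  Classical.epsilon (IsPeriodicBranch r a β)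

/-- The locally defined multiplier function `b ↦ (g^{∘ r})'(β)`, where `g` has coefficients `b`
near `a` and where `β` varies holomorphically with `b`. -/
noncomputable def multiplier {n : ℕ} (r : ℕ) (a : Fin n → ℂ) (β : ℂ) (b : Fin n → ℂ) : ℂ :=
  (iterPoly (monicPoly b) r).derivative.eval (periodicBranch r a β b)

/-- The gradient at `a` of the multiplier function: the vector of its partial derivatives with
respect to the coefficients. -/
noncomputable def multiplierGrad {n : ℕ} (r : ℕ) (a : Fin n → ℂ) (β : ℂ) : Fin n → ℂ :=
  fun k => fderiv ℂ (multiplier r a β) a (Pi.single k 1)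

/-- The locally defined map to `ℂ ^ ℓ` whose components are the multiplier functions. -/
noncomputable def multiplierMap {n ℓ : ℕ} (r : Fin ℓ → ℕ) (a : Fin n → ℂ) (β : Fin ℓ → ℂ)
    (b : Fin n → ℂ) : Fin ℓ → ℂ :=
  fun i => multiplier (r i) a (β i) b

/-- `Z⁰(n, ℓ; r_1, …, r_ℓ)`: the polynomials in `Z(n, ℓ; r_1, …, r_ℓ)` for which the gradients of
the multipliers are linearly independent for every choice of the periodic points. -/
def Z0set (n : ℕ) {ℓ : ℕ} (r : Fin ℓ → ℕ) : Set (Fin n → ℂ) :=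
  {a | a ∈ Zset n r ∧ ∀ β : Fin ℓ → ℂ, IsPeriodicTuple (monicPoly a) r β →
    LinearIndependent ℂ fun i => multiplierGrad (r i) a (β i)}

theorem eval_iterPoly (g : ℂ[X]) (r : ℕ) (z : ℂ) :
    (iterPoly g r).eval z = (fun w => g.eval w)^[r] z := by
  have := Polynomial.iterate_comp_eval (p := g) (q := X) r z
  simpa [iterPoly] using this

theorem contDiff_eval_iterPoly (n r : ℕ) :
    ContDiff ℂ ⊤ fun u : (Fin n → ℂ) × ℂ => (iterPoly (monicPoly u.1) r).eval u.2 := by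
  induction r with
  | zero => simp [iterPoly, contDiff_snd]
  | succ r ih =>
    have h : (fun u : (Fin n → ℂ) × ℂ => (iterPoly (monicPoly u.1) (r + 1)).eval u.2) =
        fun u => ((iterPoly (monicPoly u.1) r).eval u.2) ^ n +
          ∑ k : Fin n, u.1 k * ((iterPoly (monicPoly u.1) r).eval u.2) ^ (k : ℕ) := by
      funext u
      rw [eval_iterPoly, Function.iterate_succ_apply', ← eval_iterPoly]
      simp [monicPoly, eval_finsetSum]
    rw [h]
    fun_prop

/-- Local solvability and uniqueness at a simple root, by the implicit function theorem. -/
theorem exists_implicit {n r : ℕ} {a : Fin n → ℂ} {β : ℂ} (ha : a ∈ Znr n r)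
    (hβ : (iterPoly (monicPoly a) r).eval β = β) :
    ∃ ψ : (Fin n → ℂ) → ℂ, IsPeriodicBranch r a β ψ ∧
      ∀ᶠ v in 𝓝 (a, β), (iterPoly (monicPoly v.1) r).eval v.2 = v.2 → ψ v.1 = v.2 := by
  set f : (Fin n → ℂ) × ℂ → ℂ := fun u => (iterPoly (monicPoly u.1) r).eval u.2 - u.2 with hf
  have cdf : ContDiffAt ℂ ⊤ f (a, β) :=
    ((contDiff_eval_iterPoly n r).sub contDiff_snd).contDiffAt
  have hf0 : f (a, β) = 0 := by simp [hf, hβ]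
  have hd : (iterPoly (monicPoly a) r - X).derivative.eval β ≠ 0 :=
    ha β (by simp [hβ])
  have hder : ∀ z : ℂ, (fderiv ℂ f (a, β) ∘L .inr ℂ (Fin n → ℂ) ℂ) z =
      (iterPoly (monicPoly a) r - X).derivative.eval β * z := by
    have h1 : HasFDerivAt (fun z : ℂ => f (a, z))
        (fderiv ℂ f (a, β) ∘L .inr ℂ (Fin n → ℂ) ℂ) β :=
      (cdf.differentiableAt (by simp)).hasFDerivAt.comp β (hasFDerivAt_prodMk_right a β)
    have h2 : HasFDerivAt (fun z : ℂ => f (a, z)) _ β :=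
      (((iterPoly (monicPoly a) r - X).hasDerivAt β).congr_of_eventuallyEq
        (f₁ := fun z => f (a, z)) (Eventually.of_forall fun z => by simp [hf])).hasFDerivAt
    intro z
    rw [h1.unique h2]
    simp [mul_comm]
  have inv : (fderiv ℂ f (a, β) ∘L .inr ℂ (Fin n → ℂ) ℂ).IsInvertible := by
    refine ⟨ContinuousLinearEquiv.unitsEquivAut ℂ (Units.mk0 _ hd), ?_⟩
    ext
    rw [hder]
    simp
  refine ⟨cdf.implicitFunction (by simp) inv, ⟨?_, ?_, ?_⟩, ?_⟩
  · exact (cdf.contDiffAt_implicitFunction (by simp) inv).analyticAt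
  · exact cdf.implicitFunction_apply_self (by simp) inv
  · filter_upwards [cdf.eventually_apply_implicitFunction (by simp) inv] with b hb
    rw [hf0] at hb
    exact sub_eq_zero.mp hb
  · filter_upwards [cdf.eventually_apply_eq_iff_implicitFunction (by simp) inv] with v hv h
    exact hv.mp (by rw [hf0]; exact sub_eq_zero.mpr h)

theorem periodicBranch_spec {n r : ℕ} {a : Fin n → ℂ} {β : ℂ} (ha : a ∈ Znr n r)
    (hβ : (iterPoly (monicPoly a) r).eval β = β) :
    IsPeriodicBranch r a β (periodicBranch r a β) :=
  have ⟨ψ, hψ, _⟩ := exists_implicit ha hβ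
  Classical.epsilon_spec (p := IsPeriodicBranch r a β) ⟨ψ, hψ⟩

theorem IsPeriodicBranch.eventuallyEq {n r : ℕ} {a : Fin n → ℂ} {β : ℂ}
    {B B' : (Fin n → ℂ) → ℂ} (ha : a ∈ Znr n r) (hB : IsPeriodicBranch r a β B)
    (hB' : IsPeriodicBranch r a β B') : B =ᶠ[𝓝 a] B' := by
  have hβ : (iterPoly (monicPoly a) r).eval β = β := by
    have := hB.2.2.self_of_nhds
    rwa [hB.2.1] at this
  obtain ⟨ψ, -, hu⟩ := exists_implicit ha hβ
  have key : ∀ B : (Fin n → ℂ) → ℂ, IsPeriodicBranch r a β B → ∀ᶠ b in 𝓝 a, ψ b = B b := by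
    intro B hB
    have ht : Tendsto (fun b => (b, B b)) (𝓝 a) (𝓝 (a, β)) := by
      have := (continuousAt_id.prodMk hB.1.continuousAt).tendsto
      simpa [hB.2.1] using this
    filter_upwards [ht.eventually hu, hB.2.2] with b h1 h2 using h1 h2
  filter_upwards [key B hB, key B' hB'] with b h1 h2
  rw [← h1, h2]

/-! Openness is elimination theory. Periodic points are roots of `g^{∘ r}(x) - x`, monic in `x` over
the ring of coefficients, so tuples of them are finite over `ℂ ^ n`, and closed conditions on such
tuples project to closed sets (`exists_zeroSet_eq_projection`). "Exact period" and "distinct orbits"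
look like open conditions, but on `Z` they are closed: the divided difference of `g^{∘ r}` at two
`r`-periodic points is `1` if they differ, and is the multiplier, which is not `1` on `Z`, if they
coincide (`isPeriodicTuple_iff`). Implicit differentiation turns each gradient, up to the nonzero
factor multiplier minus one, into polynomials in the coefficients and the periodic point
(`mul_multiplierGrad`), so linear dependence is closed too.

A Zariski-open set with one point is dense in `ℂ ^ n`, so density follows from `x ^ n ∈ Z⁰`. There,
for a nonzero cycle, the `k`-th partial derivative of the multiplier is the multiplier times `(k/n -
1) ∑ y ^ (k - n)`, summed over the cycle. All these `y` are distinct and number at most `∑ r_i ≤ n`,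
so a linear relation among gradients is excluded by a Vandermonde determinant. The fixed point `0`
has gradient `e_1` and is handled separately; this is where the strict inequality enters. -/

/-! ### Iterates and their divided differences over a commutative ring. -/

section Step

variable {R S : Type*} [CommRing R] [CommRing S] {n : ℕ}

/-- The map `z ↦ z ^ n + a_{n-1} z ^ (n-1) + … + a_0` on a commutative ring. -/
def monicStep (a : Fin n → R) (z : R) : R := z ^ n + ∑ k : Fin n, a k * z ^ (k : ℕ)

/-- The divided difference `(g x - g y) / (x - y)` of `g = monicStep a`. -/
def stepDiff (a : Fin n → R) (x y : R) : R :=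
  (∑ i ∈ Finset.range n, x ^ i * y ^ (n - 1 - i)) +
    ∑ k : Fin n, a k * ∑ i ∈ Finset.range (k : ℕ), x ^ i * y ^ ((k : ℕ) - 1 - i)

/-- The divided difference of the `r`-th iterate of `monicStep a`. -/
def iterDiff (a : Fin n → R) (r : ℕ) (x y : R) : R :=
  ∏ j ∈ Finset.range r, stepDiff a ((monicStep a)^[j] x) ((monicStep a)^[j] y)

theorem stepDiff_mul (a : Fin n → R) (x y : R) :
    stepDiff a x y * (x - y) = monicStep a x - monicStep a y := by
  have h := fun m : ℕ => (Commute.all x y).geom_sum₂_mul m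
  simp only [stepDiff, monicStep, add_mul, h, Finset.sum_mul (s := Finset.univ), mul_assoc]
  simp only [mul_sub, Finset.sum_sub_distrib]
  ring

theorem iterDiff_mul (a : Fin n → R) (r : ℕ) (x y : R) :
    iterDiff a r x y * (x - y) = (monicStep a)^[r] x - (monicStep a)^[r] y := by
  induction r with
  | zero => simp [iterDiff]
  | succ r ih =>
    rw [Function.iterate_succ_apply', Function.iterate_succ_apply', ← stepDiff_mul, ← ih,
      iterDiff, Finset.prod_range_succ, ← iterDiff]
    ring

theorem map_monicStep (φ : R →+* S) (a : Fin n → R) (z : R) :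
    φ (monicStep a z) = monicStep (fun k => φ (a k)) (φ z) := by
  simp [monicStep]

theorem map_iterate_monicStep (φ : R →+* S) (a : Fin n → R) (r : ℕ) (z : R) :
    φ ((monicStep a)^[r] z) = (monicStep fun k => φ (a k))^[r] (φ z) :=
  (show Function.Semiconj φ (monicStep a) (monicStep fun k => φ (a k)) from
    fun z => map_monicStep φ a z).iterate_right r z

theorem map_stepDiff (φ : R →+* S) (a : Fin n → R) (x y : R) :
    φ (stepDiff a x y) = stepDiff (fun k => φ (a k)) (φ x) (φ y) := by
  simp [stepDiff]

theorem map_iterDiff (φ : R →+* S) (a : Fin n → R) (r : ℕ) (x y : R) :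
    φ (iterDiff a r x y) = iterDiff (fun k => φ (a k)) r (φ x) (φ y) := by
  simp [iterDiff, map_stepDiff, map_iterate_monicStep]

theorem stepDiff_self (a : Fin n → R) (x : R) :
    stepDiff a x x = n * x ^ (n - 1) + ∑ k : Fin n, a k * ((k : ℕ) * x ^ ((k : ℕ) - 1)) := by
  simp [stepDiff, geom_sum₂_self]

/-- Each iterate is monic of degree at least `2`, so subtracting `X` leaves the leading term alone.
Monicity over the coefficient ring is what makes periodic points integral over it. -/
theorem monic_iterate_monicStep_sub_X [IsDomain R] (hn : 2 ≤ n) (a : Fin n → R) {r : ℕ}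
    (hr : 0 < r) : ((monicStep fun k => C (a k))^[r] (X : R[X]) - X).Monic := by
  have key : ∀ p : R[X], p.Monic → 1 ≤ p.natDegree →
      (monicStep (fun k => C (a k)) p).Monic ∧ 2 ≤ (monicStep (fun k => C (a k)) p).natDegree := by
    intro p hp hd
    have hpn : (p ^ n).Monic := hp.pow n
    have hdeg : (p ^ n).natDegree = n * p.natDegree := by rw [natDegree_pow]
    have hlt : (∑ k : Fin n, C (a k) * p ^ (k : ℕ)).degree < (p ^ n).degree := by
      refine lt_of_le_of_lt (degree_sum_le _ _) ?_
      rw [Finset.sup_lt_iff (bot_lt_iff_ne_bot.2 (degree_ne_bot.2 hpn.ne_zero))]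
      intro k _
      refine lt_of_le_of_lt (degree_mul_le_of_le degree_C_le le_rfl) ?_
      rw [zero_add]
      rw [degree_eq_natDegree (hp.pow _).ne_zero, degree_eq_natDegree hpn.ne_zero, natDegree_pow,
        natDegree_pow]
      exact_mod_cast Nat.mul_lt_mul_of_pos_right k.2 hd
    refine ⟨hpn.add_of_left hlt, ?_⟩
    rw [monicStep, natDegree_add_eq_left_of_degree_lt hlt, hdeg]
    nlinarith
  have main : ∀ r : ℕ, ((monicStep fun k => C (a k))^[r + 1] (X : R[X])).Monic ∧
      2 ≤ ((monicStep fun k => C (a k))^[r + 1] (X : R[X])).natDegree := by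
    intro r
    induction r with
    | zero => exact key X monic_X (by simp)
    | succ r ih =>
      rw [Function.iterate_succ_apply']
      exact key _ ih.1 (by omega)
  obtain ⟨m, rfl⟩ := Nat.exists_eq_succ_of_ne_zero hr.ne'
  refine (main m).1.sub_of_left ?_
  rw [degree_X, degree_eq_natDegree (main m).1.ne_zero]
  exact_mod_cast (main m).2

end Step

/-! ### Translation between `iterPoly` and the ring-level iterates. -/

section Link

variable {n : ℕ} (a : Fin n → ℂ)

theorem eval_monicPoly (z : ℂ) : (monicPoly a).eval z = monicStep a z := by
  simp [monicPoly, monicStep, eval_finsetSum]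

theorem eval_monicPoly_eq : (fun z => (monicPoly a).eval z) = monicStep a :=
  funext (eval_monicPoly a)

theorem eval_iterPoly_monicPoly (r : ℕ) (z : ℂ) :
    (iterPoly (monicPoly a) r).eval z = (monicStep a)^[r] z := by
  rw [eval_iterPoly, eval_monicPoly_eq]

theorem derivative_eval_monicPoly (z : ℂ) :
    (monicPoly a).derivative.eval z = stepDiff a z z := by
  simp [monicPoly, stepDiff_self, eval_finsetSum, derivative_X_pow]

theorem derivative_eval_iterPoly (r : ℕ) (z : ℂ) :
    (iterPoly (monicPoly a) r).derivative.eval z = iterDiff a r z z := by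
  induction r with
  | zero => simp [iterPoly, iterDiff]
  | succ r ih =>
    have h : iterPoly (monicPoly a) (r + 1) = (monicPoly a).comp (iterPoly (monicPoly a) r) := by
      simp only [iterPoly, Function.iterate_succ_apply']
    rw [h, derivative_comp, eval_mul, eval_comp, ih, derivative_eval_monicPoly, iterDiff, iterDiff,
      Finset.prod_range_succ, eval_iterPoly_monicPoly]

theorem mem_Znr_iff {r : ℕ} :
    a ∈ Znr n r ↔ ∀ z, (monicStep a)^[r] z = z → iterDiff a r z z - 1 ≠ 0 := by
  simp [Znr, NoMultipleRoots, eval_iterPoly_monicPoly, derivative_eval_iterPoly, sub_eq_zero]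

end Link

/-! ### Elimination: finite projections are closed. -/

section Zariski

variable {n : ℕ}

/-- The monic relations make the quotient by `J` integral over the coefficient ring. Lying over
gives a maximal ideal above that of the point `a`, and the Nullstellensatz reads it as a point `(a,
β)`. -/
theorem exists_eval_eq_of_comap_le {σ τ : Type*} [Finite τ] [Finite σ]
    {J : Ideal (MvPolynomial (σ ⊕ τ) ℂ)} {q : τ → (MvPolynomial σ ℂ)[X]}
    (hq : ∀ i, (q i).Monic)
    (hJ : ∀ i, (q i).eval₂ (MvPolynomial.rename Sum.inl).toRingHom (MvPolynomial.X (Sum.inr i)) ∈ J)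
    {a : σ → ℂ} (ha : ∀ f : MvPolynomial σ ℂ, MvPolynomial.rename Sum.inl f ∈ J →
      MvPolynomial.eval a f = 0) :
    ∃ β : τ → ℂ, ∀ p ∈ J, MvPolynomial.eval (Sum.elim a β) p = 0 := by
  let ρ : MvPolynomial σ ℂ →ₐ[ℂ] MvPolynomial (σ ⊕ τ) ℂ := MvPolynomial.rename Sum.inl
  let π := Ideal.Quotient.mkₐ ℂ J
  let φ : MvPolynomial σ ℂ →ₐ[ℂ] MvPolynomial (σ ⊕ τ) ℂ ⧸ J := π.comp ρ
  let _ := φ.toRingHom.toAlgebra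
  have hint : Algebra.IsIntegral (MvPolynomial σ ℂ) (MvPolynomial (σ ⊕ τ) ℂ ⧸ J) := by
    refine ⟨fun y => ?_⟩
    obtain ⟨p, rfl⟩ := Ideal.Quotient.mkₐ_surjective ℂ J y
    induction p using MvPolynomial.induction_on with
    | C c =>
      have : π (MvPolynomial.C c) = algebraMap (MvPolynomial σ ℂ) _ (MvPolynomial.C c) := by
        change _ = π (ρ _)
        simp [ρ]
      change IsIntegral _ (π _)
      rw [this]
      exact isIntegral_algebraMap
    | add p q hp hq => rw [map_add]; exact hp.add hq
    | mul_X p i hp =>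
      rw [map_mul]
      refine hp.mul ?_
      rcases i with k | i
      · have : π (MvPolynomial.X (Sum.inl k)) =
            algebraMap (MvPolynomial σ ℂ) _ (MvPolynomial.X k) := by
          change _ = π (ρ _)
          simp [ρ]
        change IsIntegral _ (π _)
        rw [this]
        exact isIntegral_algebraMap
      · refine ⟨q i, hq i, ?_⟩
        have h := Polynomial.hom_eval₂ (q i) ρ.toRingHom π.toRingHom (MvPolynomial.X (Sum.inr i))
        have h0 : π.toRingHom ((q i).eval₂ ρ.toRingHom (MvPolynomial.X (Sum.inr i))) = 0 :=
          Ideal.Quotient.eq_zero_iff_mem.2 (hJ i)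
        rw [h0] at h
        exact h.symm
  have hmax : (MvPolynomial.vanishingIdeal ℂ ({a} : Set (σ → ℂ))).IsMaximal :=
    MvPolynomial.isMaximal_iff_eq_vanishingIdeal_singleton.2 ⟨a, rfl⟩
  obtain ⟨Q, hQmax, hQ⟩ := Ideal.exists_ideal_over_maximal_of_isIntegral
    (S := MvPolynomial (σ ⊕ τ) ℂ ⧸ J) (MvPolynomial.vanishingIdeal ℂ ({a} : Set (σ → ℂ))) (by
      intro f hf
      rw [MvPolynomial.mem_vanishingIdeal_iff]
      rintro _ rfl
      rw [MvPolynomial.aeval_eq_eval]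
      exact ha f (Ideal.Quotient.eq_zero_iff_mem.1 hf))
  have hM : (Q.comap π.toRingHom).IsMaximal :=
    Ideal.comap_isMaximal_of_surjective _ (Ideal.Quotient.mkₐ_surjective ℂ J)
  obtain ⟨v, hv⟩ := MvPolynomial.isMaximal_iff_eq_vanishingIdeal_singleton.1 hM
  have hva : ∀ k, v (Sum.inl k) = a k := by
    intro k
    have h1 : (MvPolynomial.X k - MvPolynomial.C (a k) : MvPolynomial σ ℂ) ∈
        MvPolynomial.vanishingIdeal ℂ ({a} : Set (σ → ℂ)) := by
      rw [MvPolynomial.mem_vanishingIdeal_iff]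
      rintro _ rfl
      simp
    rw [← hQ] at h1
    have h2 : ρ (MvPolynomial.X k - MvPolynomial.C (a k)) ∈ Q.comap π.toRingHom := h1
    rw [hv, MvPolynomial.mem_vanishingIdeal_iff] at h2
    have := h2 v rfl
    simpa [ρ, sub_eq_zero] using this
  refine ⟨fun i => v (Sum.inr i), fun p hp => ?_⟩
  have hve : Sum.elim a (fun i => v (Sum.inr i)) = v := by
    ext (k | i) <;> simp [hva]
  have h2 : p ∈ Q.comap π.toRingHom := by
    change π p ∈ Q
    have : π p = 0 := Ideal.Quotient.eq_zero_iff_mem.2 hp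
    rw [this]
    exact Q.zero_mem
  rw [hv, MvPolynomial.mem_vanishingIdeal_iff] at h2
  rw [hve]
  simpa [MvPolynomial.aeval_eq_eval] using h2 v rfl

/-- The projection to `ℂ ^ n` of a closed set that is finite over `ℂ ^ n` is closed. -/
theorem exists_zeroSet_eq_projection {τ : Type*} [Finite τ]
    {q : τ → (MvPolynomial (Fin n) ℂ)[X]} (hq : ∀ i, (q i).Monic)
    (T : Set (MvPolynomial (Fin n ⊕ τ) ℂ)) :
    ∃ I : Set (MvPolynomial (Fin n) ℂ), {a : Fin n → ℂ | ∃ β : τ → ℂ,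
      (∀ i, (q i).eval₂ (MvPolynomial.eval a) (β i) = 0) ∧
        ∀ p ∈ T, MvPolynomial.eval (Sum.elim a β) p = 0} = zeroSet I := by
  let Q : τ → MvPolynomial (Fin n ⊕ τ) ℂ := fun i =>
    (q i).eval₂ (MvPolynomial.rename Sum.inl).toRingHom (MvPolynomial.X (Sum.inr i))
  have hQ : ∀ (a : Fin n → ℂ) (β : τ → ℂ) i,
      MvPolynomial.eval (Sum.elim a β) (Q i) = (q i).eval₂ (MvPolynomial.eval a) (β i) := by
    intro a β i
    rw [Polynomial.hom_eval₂]
    congr 1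
    · ext <;> simp
    · simp
  let J : Ideal (MvPolynomial (Fin n ⊕ τ) ℂ) := Ideal.span (T ∪ Set.range Q)
  -- The elimination ideal: the contraction of `J` to the coefficient variables.
  refine ⟨{f | MvPolynomial.rename Sum.inl f ∈ J}, ?_⟩
  ext a
  constructor
  · rintro ⟨β, h1, h2⟩ f hf
    have hle : J ≤ RingHom.ker (MvPolynomial.eval (Sum.elim a β)) := by
      refine Ideal.span_le.2 ?_
      rintro p (hp | ⟨i, rfl⟩)
      · exact h2 p hp
      · exact (hQ a β i).trans (h1 i)
    have := hle hf
    rw [RingHom.mem_ker, MvPolynomial.eval_rename, Sum.elim_comp_inl] at this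
    exact this
  · intro ha
    obtain ⟨β, hβ⟩ := exists_eval_eq_of_comap_le hq
      (fun i => Ideal.subset_span (Or.inr ⟨i, rfl⟩) : ∀ i, Q i ∈ J) ha
    exact ⟨β, fun i => (hQ a β i).symm.trans (hβ _ (Ideal.subset_span (Or.inr ⟨i, rfl⟩))),
      fun p hp => hβ p (Ideal.subset_span (Or.inl hp))⟩

theorem exists_zeroSet_eq_periodic (hn : 2 ≤ n) {τ : Type*} [Finite τ] {r : τ → ℕ}
    (hr : ∀ i, 0 < r i) (T : Set (MvPolynomial (Fin n ⊕ τ) ℂ)) :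
    ∃ I : Set (MvPolynomial (Fin n) ℂ), {a : Fin n → ℂ | ∃ β : τ → ℂ,
      (∀ i, (monicStep a)^[r i] (β i) = β i) ∧
        ∀ p ∈ T, MvPolynomial.eval (Sum.elim a β) p = 0} = zeroSet I := by
  obtain ⟨I, hI⟩ := exists_zeroSet_eq_projection
    (fun i => monic_iterate_monicStep_sub_X hn
      (MvPolynomial.X : Fin n → MvPolynomial (Fin n) ℂ) (hr i)) T
  refine ⟨I, hI ▸ ?_⟩
  have h : ∀ (a : Fin n → ℂ) (z : ℂ) (m : ℕ),
      ((monicStep fun k => C (MvPolynomial.X k : MvPolynomial (Fin n) ℂ))^[m] X - X).eval₂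
        (MvPolynomial.eval a) z = (monicStep a)^[m] z - z := by
    intro a z m
    rw [eval₂_sub, eval₂_X, ← coe_eval₂RingHom, map_iterate_monicStep]
    simp
  simp only [h, sub_eq_zero]

theorem exists_zeroSet_eq_compl_Znr (hn : 2 ≤ n) {r : ℕ} (hr : 0 < r) :
    ∃ I : Set (MvPolynomial (Fin n) ℂ), (Znr n r)ᶜ = zeroSet I := by
  obtain ⟨I, hI⟩ := exists_zeroSet_eq_periodic hn (τ := Unit) (r := fun _ => r) (fun _ => hr)
    {iterDiff (fun k => MvPolynomial.X (Sum.inl k)) r (MvPolynomial.X (Sum.inr ()))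
      (MvPolynomial.X (Sum.inr ())) - 1}
  refine ⟨I, hI ▸ ?_⟩
  ext a
  simp only [Set.mem_compl_iff, mem_Znr_iff, not_forall, not_not, Set.mem_ofPred_eq,
    Set.mem_singleton_iff, forall_eq, map_sub, map_iterDiff, map_one, MvPolynomial.eval_X,
    Sum.elim_inl, Sum.elim_inr, exists_prop]
  exact ⟨fun ⟨z, h1, h2⟩ => ⟨fun _ => z, fun _ => h1, h2⟩, fun ⟨β, h1, h2⟩ => ⟨β (), h1 (), h2⟩⟩

theorem isOpen_zariski_Zset (hn : 2 ≤ n) {ℓ : ℕ} {r : Fin ℓ → ℕ} (hr : ∀ i, 0 < r i) :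
    IsOpen[zariskiTopology n] (Zset n r) := by
  let _ := zariskiTopology n
  exact isOpen_iInter_of_finite fun i => exists_zeroSet_eq_compl_Znr hn (hr i)

end Zariski

/-! ### Exact periods and distinct orbits as closed conditions on `Z`. -/

section Periodic

variable {n : ℕ}

theorem iterDiff_eq_one {a : Fin n → ℂ} {r : ℕ} {x y : ℂ} (hx : (monicStep a)^[r] x = x)
    (hy : (monicStep a)^[r] y = y) (hxy : x ≠ y) : iterDiff a r x y = 1 := by
  have h := iterDiff_mul a r x y
  rw [hx, hy] at h
  exact mul_right_cancel₀ (sub_ne_zero.2 hxy) (by rw [h, one_mul])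

theorem orbitSet_eq_of_iterate_eq {a : Fin n → ℂ} {r m : ℕ} {x y : ℂ}
    (hy : (monicStep a)^[r] y = y) (hm : m < r) (hxy : x = (monicStep a)^[m] y) :
    orbitSet (monicPoly a) x = orbitSet (monicPoly a) y := by
  have hsub : ∀ {u v : ℂ} {k : ℕ}, u = (monicStep a)^[k] v →
      orbitSet (monicPoly a) u ⊆ orbitSet (monicPoly a) v := by
    rintro u v k rfl _ ⟨i, rfl⟩
    refine ⟨i + k, ?_⟩
    simp only [eval_monicPoly_eq, Function.iterate_add_apply]
  refine (hsub hxy).antisymm (hsub (k := r - m) ?_)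
  rw [hxy, ← Function.iterate_add_apply, Nat.sub_add_cancel hm.le, hy]

/-- A divided difference equal to `1` certifies that two periodic points differ, since at coinciding
points it is the multiplier and `a ∈ Z` forbids the value `1`. Only pairs with equal periods need
testing. -/
theorem isPeriodicTuple_iff {ℓ : ℕ} {r : Fin ℓ → ℕ} (hr : ∀ i, 0 < r i) {a : Fin n → ℂ}
    (ha : a ∈ Zset n r) (β : Fin ℓ → ℂ) :
    IsPeriodicTuple (monicPoly a) r β ↔ (∀ i, (monicStep a)^[r i] (β i) = β i) ∧
      ∀ i j m, r i = r j → m < r i → (i = j → 0 < m) →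
        iterDiff a (r i) (β i) ((monicStep a)^[m] (β j)) - 1 = 0 := by
  have hZ : ∀ i z, (monicStep a)^[r i] z = z → iterDiff a (r i) z z - 1 ≠ 0 :=
    fun i => (mem_Znr_iff a).1 (Set.mem_iInter.1 ha i)
  unfold IsPeriodicTuple
  rw [eval_monicPoly_eq]
  constructor
  · rintro ⟨h1, h2⟩
    have hper : ∀ i, (monicStep a)^[r i] (β i) = β i := fun i => by
      have := Function.iterate_minimalPeriod (f := monicStep a) (x := β i)
      rwa [(h1 i).2] at this
    refine ⟨hper, fun i j m hij hm hm0 => sub_eq_zero.2 (iterDiff_eq_one (hper i) ?_ ?_)⟩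
    · rw [← Function.iterate_add_apply, add_comm, Function.iterate_add_apply, hij, hper]
    · intro he
      by_cases h : i = j
      · subst h
        exact Function.not_isPeriodicPt_of_pos_of_lt_minimalPeriod (hm0 rfl).ne'
          (by rwa [(h1 i).2]) he.symm
      · exact h2 h (orbitSet_eq_of_iterate_eq (hper j) (hij ▸ hm) he)
  · rintro ⟨hper, h⟩
    have hmin : ∀ i, Function.minimalPeriod (monicStep a) (β i) = r i := by
      intro i
      have hp : Function.IsPeriodicPt (monicStep a) (r i) (β i) := hper i
      refine (hp.minimalPeriod_le (hr i)).antisymm (not_lt.1 fun hlt => ?_)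
      -- Taking `m` to be the too small minimal period compares `β i` with itself.
      have h0 := h i i _ rfl hlt fun _ => hp.minimalPeriod_pos (hr i)
      rw [Function.iterate_minimalPeriod] at h0
      exact hZ i _ (hper i) h0
    refine ⟨fun i => ⟨hr i, hmin i⟩, fun i j hij heq => ?_⟩
    have hmem : β i ∈ orbitSet (monicPoly a) (β j) := heq ▸ ⟨0, rfl⟩
    obtain ⟨m, hm⟩ := hmem
    simp only [eval_monicPoly_eq] at hm
    have hrr : r i = r j := by
      rw [← hmin i, ← hm, Function.minimalPeriod_apply_iterate, hmin j]
      exact Function.mk_mem_periodicPts (hr j) (hper j)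
    have hm' : (monicStep a)^[m % r j] (β j) = β i := by
      rw [← hm, ← hmin j, Function.iterate_mod_minimalPeriod_eq]
    have h0 := h i j (m % r j) hrr (hrr.symm ▸ Nat.mod_lt _ (hr j)) fun h => absurd h hij
    rw [hm'] at h0
    exact hZ i _ (hper i) h0

end Periodic

/-! ### The multiplier gradient by implicit differentiation. -/

section Gradient

variable {n : ℕ}

theorem MvPolynomial.hasDerivAt_eval {σ : Type*} [Fintype σ] (p : MvPolynomial σ ℂ)
    {v : ℂ → σ → ℂ} {v' : σ → ℂ} {t : ℂ} (h : ∀ i, HasDerivAt (fun s => v s i) (v' i) t) :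
    HasDerivAt (fun s => eval (v s) p) (∑ i, eval (v t) (pderiv i p) * v' i) t := by
  classical
  induction p using MvPolynomial.induction_on with
  | C c => simpa using hasDerivAt_const t c
  | add p q hp hq =>
    simp only [map_add, add_mul, Finset.sum_add_distrib]
    exact hp.add hq
  | mul_X p i hp =>
    have := hp.mul (h i)
    simp only [map_mul, eval_X]
    refine this.congr_deriv ?_
    simp [pderiv_X, add_mul, Finset.sum_add_distrib, Finset.sum_mul, Pi.single_apply, apply_ite,
      ite_mul]
    rw [add_comm]
    exact congrArg _ (Finset.sum_congr rfl fun x _ => by ring)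

/-- The polynomial `g^{∘ r}(x) - x` in `x` and in the coefficients of `g`. -/
noncomputable def periodPoly (n r : ℕ) : MvPolynomial (Option (Fin n)) ℂ :=
  (monicStep fun k => MvPolynomial.X (some k))^[r] (MvPolynomial.X none) - MvPolynomial.X none

/-- The polynomial `(g^{∘ r})'(x)` in `x` and in the coefficients of `g`. -/
noncomputable def multPoly (n r : ℕ) : MvPolynomial (Option (Fin n)) ℂ :=
  iterDiff (fun k => MvPolynomial.X (some k)) r (MvPolynomial.X none) (MvPolynomial.X none)

/-- The `k`-th partial derivative of the multiplier, times the derivative of `g^{∘ r}(x) - x`. -/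
noncomputable def gradPoly (n r : ℕ) (k : Fin n) : MvPolynomial (Option (Fin n)) ℂ :=
  MvPolynomial.pderiv none (periodPoly n r) * MvPolynomial.pderiv (some k) (multPoly n r) -
    MvPolynomial.pderiv none (multPoly n r) * MvPolynomial.pderiv (some k) (periodPoly n r)

theorem eval_periodPoly (a : Fin n → ℂ) (x : ℂ) (r : ℕ) :
    MvPolynomial.eval (fun o => o.elim x a) (periodPoly n r) = (monicStep a)^[r] x - x := by
  simp [periodPoly, map_iterate_monicStep]

theorem eval_multPoly (a : Fin n → ℂ) (x : ℂ) (r : ℕ) :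
    MvPolynomial.eval (fun o => o.elim x a) (multPoly n r) = iterDiff a r x x := by
  simp [multPoly, map_iterDiff]

theorem eval_pderiv_periodPoly (a : Fin n → ℂ) (x : ℂ) (r : ℕ) :
    MvPolynomial.eval (fun o => o.elim x a) (MvPolynomial.pderiv none (periodPoly n r)) =
      iterDiff a r x x - 1 := by
  have h1 := MvPolynomial.hasDerivAt_eval (periodPoly n r) (t := x)
    (v := fun s o => o.elim s a) (v' := fun o => o.elim 1 0) (by
      rintro (_ | k)
      · exact hasDerivAt_id x
      · exact hasDerivAt_const x _)
  have h2 := (iterPoly (monicPoly a) r - X).hasDerivAt x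
  simp only [eval_sub, eval_iterPoly_monicPoly, eval_X, derivative_sub, derivative_X, eval_one,
    derivative_eval_iterPoly] at h2
  simp only [eval_periodPoly] at h1
  have := h1.unique h2
  simpa [Fintype.sum_option] using this

theorem multiplier_eq (r : ℕ) (a : Fin n → ℂ) (β : ℂ) (b : Fin n → ℂ) :
    multiplier r a β b =
      MvPolynomial.eval (fun o => o.elim (periodicBranch r a β b) b) (multPoly n r) := by
  rw [multiplier, derivative_eval_iterPoly, eval_multPoly]

theorem analyticAt_multiplier {r : ℕ} {a : Fin n → ℂ} {β : ℂ} (ha : a ∈ Znr n r)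
    (hβ : (monicStep a)^[r] β = β) : AnalyticAt ℂ (multiplier r a β) a := by
  have hB := periodicBranch_spec ha (by rwa [eval_iterPoly_monicPoly])
  have h : multiplier r a β = fun b => MvPolynomial.aeval
      (fun o : Option (Fin n) => o.elim (periodicBranch r a β b) b) (multPoly n r) := by
    funext b
    rw [multiplier_eq, MvPolynomial.aeval_eq_eval]
  rw [h]
  refine AnalyticAt.aeval_mvPolynomial ?_ _
  rintro (_ | k)
  · exact hB.1
  · exact (ContinuousLinearMap.proj (R := ℂ) (φ := fun _ : Fin n => ℂ) k).analyticAt a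

/-- A smooth function has, in the `k`-th coordinate direction, the partial derivative given by
`fderiv`. -/
theorem hasDerivAt_add_single {f : (Fin n → ℂ) → ℂ} {a : Fin n → ℂ} (hf : DifferentiableAt ℂ f a)
    (k : Fin n) :
    HasDerivAt (fun s : ℂ => f (a + Pi.single k s)) (fderiv ℂ f a (Pi.single k 1)) 0 := by
  have hc : HasDerivAt (fun s : ℂ => a + Pi.single k s) (Pi.single k (1 : ℂ)) 0 := by
    refine HasDerivAt.const_add a (hasDerivAt_pi.2 fun j => ?_)
    by_cases h : j = k
    · subst h
      simpa using hasDerivAt_id' (0 : ℂ)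
    · simpa [h] using hasDerivAt_const (0 : ℂ) (0 : ℂ)
  have hf' : HasFDerivAt f (fderiv ℂ f a) (a + Pi.single k (0 : ℂ)) := by
    simpa using hf.hasFDerivAt
  exact hf'.comp_hasDerivAt 0 hc

theorem tendsto_add_single (a : Fin n → ℂ) (k : Fin n) :
    Tendsto (fun s : ℂ => a + Pi.single k s) (𝓝 0) (𝓝 a) := by
  have : Continuous fun s : ℂ => a + Pi.single k s :=
    continuous_const.add (continuous_single (A := fun _ : Fin n => ℂ) k)
  simpa using this.tendsto 0

/-- Differentiating `F = 0` (with `F` the `periodPoly`) and the multiplier along the branch gives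
two linear equations in the derivative of the branch; eliminating it, without dividing by `∂F/∂x`,
keeps everything polynomial. -/
theorem mul_multiplierGrad {r : ℕ} {a : Fin n → ℂ} {β : ℂ} (ha : a ∈ Znr n r)
    (hβ : (monicStep a)^[r] β = β) (k : Fin n) :
    (iterDiff a r β β - 1) * multiplierGrad r a β k =
      MvPolynomial.eval (fun o => o.elim β a) (gradPoly n r k) := by
  have hB := periodicBranch_spec ha (by rwa [eval_iterPoly_monicPoly])
  set B := periodicBranch r a β with hBdef
  have hBd := hasDerivAt_add_single hB.1.differentiableAt k
  have hpt : (fun o : Option (Fin n) =>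
      o.elim (B (a + Pi.single k (0 : ℂ))) (a + Pi.single k (0 : ℂ))) = fun o => o.elim β a := by
    simp [hB.2.1]
  have hv : ∀ o : Option (Fin n), HasDerivAt
      (fun s : ℂ => o.elim (B (a + Pi.single k s)) (a + Pi.single k s))
      (o.elim (fderiv ℂ B a (Pi.single k 1)) (Pi.single k 1)) 0 := by
    rintro (_ | j)
    · exact hBd
    · simpa using hasDerivAt_add_single
        (ContinuousLinearMap.proj (R := ℂ) (φ := fun _ : Fin n => ℂ) j).differentiableAt (a := a) k
  have hF := MvPolynomial.hasDerivAt_eval (periodPoly n r) hv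
  have hG := MvPolynomial.hasDerivAt_eval (multPoly n r) hv
  have hM := hasDerivAt_add_single (analyticAt_multiplier ha hβ).differentiableAt k
  simp only [multiplier_eq, ← hBdef] at hM
  have h1 := hM.unique hG
  have hF0 : HasDerivAt (fun s : ℂ => MvPolynomial.eval
      (fun o : Option (Fin n) => o.elim (B (a + Pi.single k s)) (a + Pi.single k s))
      (periodPoly n r)) 0 0 := by
    refine (hasDerivAt_const (0 : ℂ) (0 : ℂ)).congr_of_eventuallyEq ?_
    filter_upwards [(tendsto_add_single a k).eventually hB.2.2] with s hs
    rw [eval_periodPoly, ← eval_iterPoly_monicPoly, hs, sub_self]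
  have h2 := hF0.unique hF
  rw [hpt] at h1 h2
  simp only [Fintype.sum_option, Option.elim_none, Option.elim_some, Pi.single_apply, mul_ite,
    mul_one, mul_zero, Finset.sum_ite_eq', Finset.mem_univ, if_true] at h1 h2
  rw [← eval_pderiv_periodPoly, gradPoly, map_sub, map_mul, map_mul, multiplierGrad]
  linear_combination MvPolynomial.eval (fun o => o.elim β a)
    (MvPolynomial.pderiv none (periodPoly n r)) * h1 - MvPolynomial.eval (fun o => o.elim β a)
    (MvPolynomial.pderiv none (multPoly n r)) * h2

end Gradient

/-! ### Linear independence through determinants, and Vandermonde. -/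

section LinearAlgebra

variable {K : Type*} [Field K] {ι κ : Type*}

theorem linearIndependent_smul_iff_of_ne_zero {V : Type*} [AddCommGroup V] [Module K V]
    {c : ι → K} (hc : ∀ i, c i ≠ 0) {v : ι → V} :
    LinearIndependent K (fun i => c i • v i) ↔ LinearIndependent K v :=
  LinearIndependent.units_smul_iff v fun i => Units.mk0 (c i) (hc i)

theorem linearIndependent_iff_exists_det_ne_zero [Fintype ι] [DecidableEq ι] [Fintype κ]
    (P : Matrix ι κ K) :
    LinearIndependent K (fun i => P i) ↔ ∃ L : Matrix κ ι K, (P * L).det ≠ 0 := by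
  classical
  constructor
  · intro h
    have hinj : Function.Injective P.vecMulLinear := by
      rw [Matrix.coe_vecMulLinear]
      exact Matrix.vecMul_injective_iff.2 h
    obtain ⟨f, hf⟩ := P.vecMulLinear.exists_leftInverse_of_injective (LinearMap.ker_eq_bot.2 hinj)
    refine ⟨LinearMap.toMatrixRight' f, ?_⟩
    have : P * LinearMap.toMatrixRight' f = 1 := by
      apply Matrix.toLinearMapRight'.injective
      rw [Matrix.toLinearMapRight'_mul, Matrix.toLinearMapRight'_one, ← hf]
      simp [Matrix.toLinearMapRight']
      rfl
    rw [this, Matrix.det_one]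
    exact one_ne_zero
  · rintro ⟨L, hL⟩
    have h : LinearIndependent K (fun i => (P * L) i) :=
      Matrix.linearIndependent_rows_iff_isUnit.2
        ((Matrix.isUnit_iff_isUnit_det _).2 (isUnit_iff_ne_zero.2 hL))
    refine LinearIndependent.of_comp L.vecMulLinear ?_
    convert h using 2
    exact (Matrix.mul_apply_eq_vecMul P L _).symm

theorem rank_eq_card_iff_linearIndependent [Fintype ι] [Fintype κ] (P : Matrix ι κ K) :
    P.rank = Fintype.card ι ↔ LinearIndependent K (fun i => P i) := by
  rw [linearIndependent_iff_card_eq_finrank_span, Set.finrank, P.rank_eq_finrank_span_row, eq_comm]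
  rfl

theorem eq_zero_of_sum_mul_pow_eq_zero [Fintype ι] {p : ι → K} (hp : Function.Injective p)
    {w : ι → K} {m : ℕ} (hm : Fintype.card ι ≤ m) (h : ∀ k < m, ∑ x, w x * p x ^ k = 0) :
    w = 0 := by
  let e := Fintype.equivFin ι
  have h0 := Matrix.eq_zero_of_forall_pow_sum_mul_pow_eq_zero (f := p ∘ e.symm)
    (v := w ∘ e.symm) (hp.comp e.symm.injective) (fun i => by
      rw [← h i (i.2.trans_le hm), ← e.symm.sum_comp]
      exact Finset.sum_congr rfl fun x _ => rfl)
  funext x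
  simpa using congrFun h0 (e x)

end LinearAlgebra

/-! ### Zariski-openness of `Z⁰` in `Z`. -/

section Openness

variable {n ℓ : ℕ} {r : Fin ℓ → ℕ}

/-- The matrix of the polynomials `gradPoly`, in the coefficients and the periodic points. -/
noncomputable def gradMatrixPoly (n : ℕ) {ℓ : ℕ} (r : Fin ℓ → ℕ) :
    Matrix (Fin ℓ) (Fin n) (MvPolynomial (Fin n ⊕ Fin ℓ) ℂ) :=
  Matrix.of fun i k => MvPolynomial.rename (fun o : Option (Fin n) => o.elim (Sum.inr i) Sum.inl)
    (gradPoly n (r i) k)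

/-- The matrix of the values of the polynomials `gradPoly`. -/
noncomputable def gradMatrix (r : Fin ℓ → ℕ) (a : Fin n → ℂ) (β : Fin ℓ → ℂ) :
    Matrix (Fin ℓ) (Fin n) ℂ :=
  Matrix.of fun i k => MvPolynomial.eval (fun o => o.elim (β i) a) (gradPoly n (r i) k)

theorem map_gradMatrixPoly (a : Fin n → ℂ) (β : Fin ℓ → ℂ) :
    (gradMatrixPoly n r).map (MvPolynomial.eval (Sum.elim a β)) = gradMatrix r a β := by
  ext i k
  simp only [gradMatrixPoly, gradMatrix, Matrix.map_apply, Matrix.of_apply,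
    MvPolynomial.eval_rename]
  congr 2
  funext o
  cases o <;> rfl

theorem linearIndependent_multiplierGrad_iff {a : Fin n → ℂ} {β : Fin ℓ → ℂ}
    (ha : a ∈ Zset n r) (hβ : ∀ i, (monicStep a)^[r i] (β i) = β i) :
    LinearIndependent ℂ (fun i => multiplierGrad (r i) a (β i)) ↔
      LinearIndependent ℂ fun i => gradMatrix r a β i := by
  rw [← linearIndependent_smul_iff_of_ne_zero fun i =>
    (mem_Znr_iff a).1 (Set.mem_iInter.1 ha i) (β i) (hβ i)]
  have : (fun i => gradMatrix r a β i) =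
      fun i => (iterDiff a (r i) (β i) (β i) - 1) • multiplierGrad (r i) a (β i) := by
    funext i k
    exact (mul_multiplierGrad (Set.mem_iInter.1 ha i) (hβ i) k).symm
  rw [this]

/-- The polynomial conditions on `(a, β)` which say that `β` is a periodic tuple with linearly
dependent multiplier gradients. -/
def dependentConditions (n : ℕ) {ℓ : ℕ} (r : Fin ℓ → ℕ) :
    Set (MvPolynomial (Fin n ⊕ Fin ℓ) ℂ) :=
  {p | ∃ i j m, r i = r j ∧ m < r i ∧ (i = j → 0 < m) ∧
    p = iterDiff (fun k => MvPolynomial.X (Sum.inl k)) (r i) (MvPolynomial.X (Sum.inr i))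
      ((monicStep fun k => MvPolynomial.X (Sum.inl k))^[m] (MvPolynomial.X (Sum.inr j))) - 1} ∪
  {p | ∃ L : Matrix (Fin n) (Fin ℓ) ℂ, p = (gradMatrixPoly n r *
    L.map (MvPolynomial.C : ℂ →+* MvPolynomial (Fin n ⊕ Fin ℓ) ℂ)).det}

theorem forall_dependentConditions_iff (a : Fin n → ℂ) (β : Fin ℓ → ℂ) :
    (∀ p ∈ dependentConditions n r, MvPolynomial.eval (Sum.elim a β) p = 0) ↔
      (∀ i j m, r i = r j → m < r i → (i = j → 0 < m) →
        iterDiff a (r i) (β i) ((monicStep a)^[m] (β j)) - 1 = 0) ∧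
      ¬ LinearIndependent ℂ fun i => gradMatrix r a β i := by
  have hdet : ∀ L : Matrix (Fin n) (Fin ℓ) ℂ, MvPolynomial.eval (Sum.elim a β)
      (gradMatrixPoly n r *
        L.map (MvPolynomial.C : ℂ →+* MvPolynomial (Fin n ⊕ Fin ℓ) ℂ)).det =
      (gradMatrix r a β * L).det := by
    intro L
    rw [RingHom.map_det, RingHom.mapMatrix_apply, Matrix.map_mul, map_gradMatrixPoly]
    congr 2
    ext i k
    simp
  have hcond : ∀ i j m, MvPolynomial.eval (Sum.elim a β)
      (iterDiff (fun k => MvPolynomial.X (Sum.inl k)) (r i) (MvPolynomial.X (Sum.inr i))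
        ((monicStep fun k => MvPolynomial.X (Sum.inl k))^[m] (MvPolynomial.X (Sum.inr j))) - 1) =
      iterDiff a (r i) (β i) ((monicStep a)^[m] (β j)) - 1 := by
    intro i j m
    simp [map_iterDiff, map_iterate_monicStep]
  rw [linearIndependent_iff_exists_det_ne_zero]
  push Not
  constructor
  · refine fun h => ⟨fun i j m h1 h2 h3 => ?_, fun L => ?_⟩
    · rw [← hcond]
      exact h _ (Or.inl ⟨i, j, m, h1, h2, h3, rfl⟩)
    · rw [← hdet]
      exact h _ (Or.inr ⟨L, rfl⟩)
  · rintro ⟨h1, h2⟩ p (⟨i, j, m, hij, hm, h0, rfl⟩ | ⟨L, rfl⟩)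
    · rw [hcond]
      exact h1 i j m hij hm h0
    · rw [hdet]
      exact h2 L

theorem exists_isOpen_zariski_Z0set (hn : 2 ≤ n) (hr : ∀ i, 0 < r i) :
    ∃ U, IsOpen[zariskiTopology n] U ∧ Z0set n r = Zset n r ∩ U := by
  obtain ⟨I, hI⟩ := exists_zeroSet_eq_periodic hn hr (dependentConditions n r)
  refine ⟨(zeroSet I)ᶜ, ⟨I, compl_compl _⟩, ?_⟩
  rw [← hI]
  ext a
  simp only [Z0set, Set.mem_ofPred_eq, Set.mem_inter_iff, Set.mem_compl_iff, not_exists]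
  refine and_congr_right fun ha => forall_congr' fun β => ?_
  rw [forall_dependentConditions_iff, isPeriodicTuple_iff hr ha]
  constructor
  · rintro h ⟨h1, h2, h3⟩
    exact h3 ((linearIndependent_multiplierGrad_iff ha h1).1 (h ⟨h1, h2⟩))
  · rintro h ⟨h1, h2⟩
    by_contra h3
    exact h ⟨h1, h2, fun h4 => h3 ((linearIndependent_multiplierGrad_iff ha h1).2 h4)⟩

end Openness

/-! ### Density of nonempty Zariski-open sets. -/

section Density

variable {n : ℕ}

/-- On the line from `a` to `b`, `f` restricts to a nonzero polynomial in one variable, which has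
finitely many roots; so nonzeros accumulate at `a`. -/
theorem dense_eval_ne_zero {f : MvPolynomial (Fin n) ℂ} {b : Fin n → ℂ}
    (hb : MvPolynomial.eval b f ≠ 0) : Dense {a | MvPolynomial.eval a f ≠ 0} := by
  intro a
  let q : ℂ[X] := MvPolynomial.eval₂ C (fun k => C (a k) + X * C (b k - a k)) f
  have hq : ∀ t, q.eval t = MvPolynomial.eval (a + t • (b - a)) f := by
    intro t
    have := MvPolynomial.hom_eval₂ f C (Polynomial.evalRingHom t)
      fun k => C (a k) + X * C (b k - a k)
    rw [coe_evalRingHom] at this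
    rw [this, MvPolynomial.eval, MvPolynomial.coe_eval₂Hom]
    congr 1
    · ext; simp
    · funext k; simp
  have hq0 : q ≠ 0 := by
    intro h
    have := hq 1
    simp [h] at this
    exact hb this.symm
  have hev : ∀ᶠ t in 𝓝[≠] (0 : ℂ), ¬ q.IsRoot t := by
    have hfin : (q.rootSet ℂ \ {0}).Finite := (q.rootSet_finite ℂ).subset Set.sdiff_subset
    filter_upwards [nhdsWithin_le_nhds (hfin.isClosed.compl_mem_nhds fun h => h.2 rfl),
      self_mem_nhdsWithin] with t h1 h2 h3
    exact h1 ⟨by simpa [mem_rootSet, hq0] using h3, h2⟩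
  have ht : Tendsto (fun t : ℂ => a + t • (b - a)) (𝓝[≠] 0) (𝓝 a) := by
    have : Continuous fun t : ℂ => a + t • (b - a) := by fun_prop
    simpa using (this.tendsto 0).mono_left nhdsWithin_le_nhds
  refine mem_closure_of_tendsto ht ?_
  filter_upwards [hev] with t h
  rw [← hq]
  exact h

theorem dense_of_isOpen_zariski {U : Set (Fin n → ℂ)} (hU : IsOpen[zariskiTopology n] U)
    (hne : U.Nonempty) : Dense U := by
  obtain ⟨I, hI⟩ := hU
  obtain ⟨b, hb⟩ := hne
  have hbI : b ∉ zeroSet I := hI ▸ fun h => h hb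
  simp only [zeroSet, Set.mem_ofPred_eq, not_forall] at hbI
  obtain ⟨f, hf, hfb⟩ := hbI
  refine (dense_eval_ne_zero hfb).mono fun a ha => ?_
  by_contra h
  have : a ∈ zeroSet I := hI ▸ h
  exact ha (this f hf)

theorem closure_subset_closure_zariski (S : Set (Fin n → ℂ)) :
    closure S ⊆ closure[zariskiTopology n] S := by
  refine closure_minimal (@subset_closure _ (zariskiTopology n) _) ?_
  obtain ⟨I, hI⟩ := (@isClosed_closure _ (zariskiTopology n) S).isOpen_compl
  rw [compl_compl] at hI
  rw [hI]
  have : zeroSet I = ⋂ f ∈ I, {a | MvPolynomial.eval a f = 0} := by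
    ext a; simp [zeroSet]
  rw [this]
  exact isClosed_biInter fun f _ => isClosed_eq (MvPolynomial.continuous_eval f) continuous_const

end Density

/-! ### Rank of the multiplier map: the Jacobian rows are the gradients. -/

section Rank

variable {n ℓ : ℕ} {r : Fin ℓ → ℕ}

theorem analyticAt_multiplierMap {a : Fin n → ℂ} {β : Fin ℓ → ℂ}
    (ha : a ∈ Zset n r) (hβ : ∀ i, (monicStep a)^[r i] (β i) = β i) :
    AnalyticAt ℂ (multiplierMap r a β) a :=
  AnalyticAt.pi fun i => analyticAt_multiplier (Set.mem_iInter.1 ha i) (hβ i)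

theorem finrank_range_fderiv_multiplierMap_iff {a : Fin n → ℂ} {β : Fin ℓ → ℂ}
    (ha : a ∈ Zset n r) (hβ : ∀ i, (monicStep a)^[r i] (β i) = β i) :
    Module.finrank ℂ (fderiv ℂ (multiplierMap r a β) a).range = ℓ ↔
      LinearIndependent ℂ fun i => multiplierGrad (r i) a (β i) := by
  let P : Matrix (Fin ℓ) (Fin n) ℂ := Matrix.of fun i => multiplierGrad (r i) a (β i)
  have hP : (fderiv ℂ (multiplierMap r a β) a).toLinearMap = P.mulVecLin := by
    refine LinearMap.pi_ext' fun k => LinearMap.ext_ring (funext fun i => ?_)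
    have h := fderiv_pi (𝕜 := ℂ) (φ := fun i => multiplier (r i) a (β i)) (x := a)
      fun i => (analyticAt_multiplier (Set.mem_iInter.1 ha i) (hβ i)).differentiableAt
    have h' : fderiv ℂ (multiplierMap r a β) a = _ := h
    rw [h']
    simp [P, multiplierGrad]
  have h := rank_eq_card_iff_linearIndependent P
  rw [Fintype.card_fin, Matrix.rank, ← hP] at h
  exact h

end Rank

/-! ### Multipliers and their gradients at `x ^ n`. -/

section Power

variable {n : ℕ}

theorem monicPoly_zero : monicPoly (0 : Fin n → ℂ) = X ^ n := by
  simp [monicPoly]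

theorem monicStep_zero (z : ℂ) : monicStep (0 : Fin n → ℂ) z = z ^ n := by
  simp [monicStep]

theorem iterDiff_zero_mul (hn : 1 ≤ n) (r : ℕ) (z : ℂ) :
    iterDiff (0 : Fin n → ℂ) r z z * z = n ^ r * (monicStep (0 : Fin n → ℂ))^[r] z := by
  induction r with
  | zero => simp [iterDiff]
  | succ r ih =>
    rw [iterDiff, Finset.prod_range_succ, ← iterDiff, mul_right_comm, ih,
      Function.iterate_succ_apply', monicStep_zero, stepDiff_self]
    set y := (monicStep (0 : Fin n → ℂ))^[r] z
    have : y ^ n = y * y ^ (n - 1) := by rw [← pow_succ', Nat.sub_add_cancel hn]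
    simp [this]
    ring

/-- The multiplier is `0` at the point `0` and `n ^ r` at every other periodic point, never `1`. -/
theorem zero_mem_Znr (hn : 2 ≤ n) {r : ℕ} (hr : 0 < r) : (0 : Fin n → ℂ) ∈ Znr n r := by
  rw [mem_Znr_iff]
  intro z hz h
  have h1 := iterDiff_zero_mul (by omega : 1 ≤ n) r z
  rw [hz] at h1
  rw [sub_eq_zero] at h
  by_cases h0 : z = 0
  · subst h0
    obtain ⟨m, rfl⟩ := Nat.exists_eq_succ_of_ne_zero hr.ne'
    rw [iterDiff, Finset.prod_range_succ', Function.iterate_zero, id, stepDiff_self,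
      zero_pow (by omega : n - 1 ≠ 0)] at h
    simp at h
  · rw [h] at h1
    have h2 : (n : ℂ) ^ r = 1 := (mul_right_cancel₀ h0 h1).symm
    have h3 : n ^ r = 1 := by exact_mod_cast h2
    have := Nat.one_lt_pow hr.ne' (by omega : 1 < n)
    omega

theorem monicStep_single (k : Fin n) (s z : ℂ) :
    monicStep (Pi.single k s) z = z ^ n + s * z ^ (k : ℕ) := by
  simp [monicStep, Pi.single_apply]

theorem stepDiff_single_self (k : Fin n) (s z : ℂ) :
    stepDiff (Pi.single k s) z z = n * z ^ (n - 1) + s * ((k : ℕ) * z ^ ((k : ℕ) - 1)) := by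
  simp [stepDiff_self, Pi.single_apply]

/-- The logarithmic derivative of the multiplier of a nonzero cycle of `x ^ n` along the family
`x ^ n + s x ^ k`. -/
theorem hasDerivAt_prod_of_orbit (hn : 2 ≤ n) {k r : ℕ} {y : ℕ → ℂ → ℂ}
    (hy : ∀ j s, y (j + 1) s = y j s ^ n + s * y j s ^ k) (hd : DifferentiableAt ℂ (y 0) 0)
    (hper : y r =ᶠ[𝓝 0] y 0) (hne : y 0 0 ≠ 0) :
    HasDerivAt (fun s => ∏ j ∈ Finset.range r,
        (n * y j s ^ (n - 1) + s * (k * y j s ^ (k - 1))))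
      ((∏ j ∈ Finset.range r, n * y j 0 ^ (n - 1)) * ((k / n - 1) *
        ∑ j ∈ Finset.range r, y j 0 ^ k / y j 0 ^ n)) 0 := by
  have hn0 : (n : ℂ) ≠ 0 := by exact_mod_cast (by omega : n ≠ 0)
  have hdiff : ∀ j, ∃ d, HasDerivAt (y j) d 0 := by
    intro j
    induction j with
    | zero => exact ⟨_, hd.hasDerivAt⟩
    | succ j ih =>
      obtain ⟨d, hd⟩ := ih
      have := (hd.fun_pow n).fun_add ((hasDerivAt_id' (0 : ℂ)).fun_mul (hd.fun_pow k))
      exact ⟨_, this.congr_of_eventuallyEq (Eventually.of_forall fun s => hy j s)⟩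
  choose D hD using hdiff
  have hyn : ∀ j, y j 0 ≠ 0 := by
    intro j
    induction j with
    | zero => exact hne
    | succ j ih => simpa [hy] using pow_ne_zero n ih
  have hrec : ∀ j, D (j + 1) = n * y j 0 ^ (n - 1) * D j + y j 0 ^ k := by
    intro j
    have h := ((hD j).fun_pow n).fun_add ((hasDerivAt_id' (0 : ℂ)).fun_mul ((hD j).fun_pow k))
    have h' := (hD (j + 1)).unique
      (h.congr_of_eventuallyEq (Eventually.of_forall fun s => hy j s))
    rw [h']
    ring
  have hDr : D r = D 0 := ((hD r).congr_of_eventuallyEq hper.symm).unique (hD 0)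
  have hyr : y r 0 = y 0 0 := hper.self_of_nhds
  have hpn : ∀ j, y j 0 ^ n = y j 0 ^ (n - 1) * y j 0 := fun j => by
    rw [← pow_succ, Nat.sub_add_cancel (by omega)]
  -- For `u j = D j / y j 0` the recursion is affine with constant slope `n`; summed over the cycle
  -- it gives `(1 - n) ∑ u j = ∑ y ^ (k - n)`, so the unknown motion of the orbit drops out.
  have hu : ∀ j, D (j + 1) / y (j + 1) 0 = n * (D j / y j 0) + y j 0 ^ k / y j 0 ^ n := by
    intro j
    have h1 := pow_ne_zero (n - 1) (hyn j)
    have h2 := hyn j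
    rw [hrec, hy, zero_mul, add_zero, hpn]
    field_simp
  have htel : ∑ j ∈ Finset.range r, D (j + 1) / y (j + 1) 0 =
      ∑ j ∈ Finset.range r, D j / y j 0 := by
    have := Finset.sum_range_sub (fun j => D j / y j 0) r
    rw [hDr, hyr, sub_self, Finset.sum_sub_distrib] at this
    exact sub_eq_zero.1 this
  simp only [hu, Finset.sum_add_distrib, ← Finset.mul_sum] at htel
  have hfac : ∀ j, HasDerivAt (fun s => n * y j s ^ (n - 1) + s * (k * y j s ^ (k - 1)))
      (n * y j 0 ^ (n - 1) * ((n - 1) * (D j / y j 0) + k / n * (y j 0 ^ k / y j 0 ^ n))) 0 := by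
    intro j
    have h := (((hD j).fun_pow (n - 1)).const_mul (n : ℂ)).fun_add
      ((hasDerivAt_id' (0 : ℂ)).fun_mul (((hD j).fun_pow (k - 1)).const_mul (k : ℂ)))
    refine h.congr_deriv ?_
    have h2 := hyn j
    have h1 := pow_ne_zero (n - 1) h2
    have h3 : y j 0 ^ (n - 1) = y j 0 ^ (n - 1 - 1) * y j 0 := by
      rw [← pow_succ, Nat.sub_add_cancel (by omega)]
    -- For `k = 0` the exponent truncates, but the factor `k` kills both sides.
    have h4 : (k : ℂ) * y j 0 ^ k = k * y j 0 ^ (k - 1) * y j 0 := by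
      rcases k with _ | k
      · simp
      · simp [pow_succ, mul_assoc]
    have h5 : ((n - 1 : ℕ) : ℂ) = n - 1 := by
      rw [Nat.cast_sub (by omega), Nat.cast_one]
    rw [h5, hpn]
    have h6 : (n : ℂ) * y j 0 ^ (n - 1) *
        ((n - 1) * (D j / y j 0) + k / n * (y j 0 ^ k / (y j 0 ^ (n - 1) * y j 0))) =
        n * (n - 1) * (y j 0 ^ (n - 1) / y j 0) * D j + k * y j 0 ^ k / y j 0 := by
      field_simp
    rw [h6, h4, h3]
    field_simp
    ring
  have hprod := HasDerivAt.fun_finsetProd (u := Finset.range r) fun j _ => hfac j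
  refine hprod.congr_deriv ?_
  have hterm : ∀ j ∈ Finset.range r, (∏ i ∈ (Finset.range r).erase j,
      (n * y i 0 ^ (n - 1) + 0 * (k * y i 0 ^ (k - 1)))) •
      (n * y j 0 ^ (n - 1) * ((n - 1) * (D j / y j 0) + k / n * (y j 0 ^ k / y j 0 ^ n))) =
      (∏ i ∈ Finset.range r, n * y i 0 ^ (n - 1)) *
        ((n - 1) * (D j / y j 0) + k / n * (y j 0 ^ k / y j 0 ^ n)) := by
    intro j hj
    rw [← Finset.prod_erase_mul _ _ hj, smul_eq_mul]
    simp only [zero_mul, add_zero]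
    ring
  rw [Finset.sum_congr rfl hterm, ← Finset.mul_sum, Finset.sum_add_distrib, ← Finset.mul_sum,
    ← Finset.mul_sum]
  linear_combination (∏ i ∈ Finset.range r, n * y i 0 ^ (n - 1)) * htel

theorem hasDerivAt_multiplier_zero {r : ℕ} {β : ℂ} (ha : (0 : Fin n → ℂ) ∈ Znr n r)
    (hβ : (monicStep (0 : Fin n → ℂ))^[r] β = β) (k : Fin n) :
    HasDerivAt (fun s : ℂ => multiplier r 0 β (Pi.single k s)) (multiplierGrad r 0 β k) 0 := by
  simpa [multiplierGrad] using
    hasDerivAt_add_single (analyticAt_multiplier ha hβ).differentiableAt k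

theorem multiplierGrad_zero_of_ne_zero (hn : 2 ≤ n) {r : ℕ} {β : ℂ}
    (ha : (0 : Fin n → ℂ) ∈ Znr n r) (hβ : (monicStep (0 : Fin n → ℂ))^[r] β = β) (h0 : β ≠ 0)
    (k : Fin n) :
    multiplierGrad r 0 β k = iterDiff (0 : Fin n → ℂ) r β β * (((k : ℕ) / n - 1) *
      ∑ j ∈ Finset.range r, (monicStep (0 : Fin n → ℂ))^[j] β ^ (k : ℕ) /
        (monicStep (0 : Fin n → ℂ))^[j] β ^ n) := by
  have hB := periodicBranch_spec ha (by rwa [eval_iterPoly_monicPoly])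
  let y : ℕ → ℂ → ℂ := fun j s =>
    (monicStep (Pi.single k s))^[j] (periodicBranch r 0 β (Pi.single k s))
  have hy0 : ∀ j, y j 0 = (monicStep (0 : Fin n → ℂ))^[j] β := by
    intro j
    simp [y, hB.2.1]
  have hlim := tendsto_add_single (0 : Fin n → ℂ) k
  have h1 := hasDerivAt_add_single hB.1.differentiableAt k
  simp only [zero_add] at hlim h1
  have h := hasDerivAt_prod_of_orbit hn (k := k) (r := r) (y := y)
    (fun j s => by simp only [y, Function.iterate_succ_apply', monicStep_single])
    h1.differentiableAt
    (by
      filter_upwards [hlim.eventually hB.2.2] with s hs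
      rw [eval_iterPoly_monicPoly] at hs
      exact hs)
    (by rwa [hy0])
  have h2 := (hasDerivAt_multiplier_zero ha hβ k).unique (h.congr_of_eventuallyEq
    (Eventually.of_forall fun s => by
      simp only [multiplier, derivative_eval_iterPoly, iterDiff, stepDiff_single_self, y]))
  rw [h2]
  simp only [hy0, iterDiff, stepDiff_self, Pi.zero_apply, zero_mul, Finset.sum_const_zero, add_zero]

/-- Near the fixed point `0` the multiplier is `n x ^ (n-1) + s k x ^ (k-1)`. Since `n ≥ 3`, the
first term is of second order in the moving point, leaving only `k = 1`. -/
theorem multiplierGrad_zero_zero (hn : 3 ≤ n) (k : Fin n) :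
    multiplierGrad 1 (0 : Fin n → ℂ) 0 k = if (k : ℕ) = 1 then 1 else 0 := by
  have ha : (0 : Fin n → ℂ) ∈ Znr n 1 := zero_mem_Znr (by omega) one_pos
  have hβ : (monicStep (0 : Fin n → ℂ))^[1] 0 = 0 := by
    rw [Function.iterate_one, monicStep_zero, zero_pow (by omega)]
  have hB := periodicBranch_spec ha (by rwa [eval_iterPoly_monicPoly])
  have h1 := hasDerivAt_add_single hB.1.differentiableAt k
  simp only [zero_add] at h1
  have h := ((h1.fun_pow (n - 1)).const_mul (n : ℂ)).fun_add ((hasDerivAt_id' (0 : ℂ)).fun_mul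
    ((h1.fun_pow ((k : ℕ) - 1)).const_mul ((k : ℕ) : ℂ)))
  have h2 := (hasDerivAt_multiplier_zero ha hβ k).unique (h.congr_of_eventuallyEq
    (Eventually.of_forall fun s => by
      simp [multiplier, derivative_eval_iterPoly, iterDiff, stepDiff_single_self]))
  rw [h2]
  simp only [Pi.single_zero, hB.2.1, zero_pow (by omega : n - 1 - 1 ≠ 0)]
  rcases hk : (k : ℕ) with _ | _ | m <;> simp

end Power

/-! ### Independence of the gradients at `x ^ n`. -/

section PowerIndependence

variable {n ℓ : ℕ} {r : Fin ℓ → ℕ}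

theorem iterate_eq_of_isPeriodicTuple {a : Fin n → ℂ} {β : Fin ℓ → ℂ}
    (h : IsPeriodicTuple (monicPoly a) r β) (i : Fin ℓ) : (monicStep a)^[r i] (β i) = β i := by
  have h2 := (h.1 i).2
  rw [eval_monicPoly_eq] at h2
  rw [← h2]
  exact Function.iterate_minimalPeriod

theorem injective_orbits_of_isPeriodicTuple {a : Fin n → ℂ} {β : Fin ℓ → ℂ}
    (h : IsPeriodicTuple (monicPoly a) r β) {i j : Fin ℓ} {s t : ℕ} (hs : s < r i) (ht : t < r j)
    (hst : (monicStep a)^[s] (β i) = (monicStep a)^[t] (β j)) : i = j ∧ s = t := by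
  have hij : i = j := by
    by_contra hne
    refine h.2 hne ?_
    rw [← orbitSet_eq_of_iterate_eq (iterate_eq_of_isPeriodicTuple h i) hs rfl, hst,
      orbitSet_eq_of_iterate_eq (iterate_eq_of_isPeriodicTuple h j) ht rfl]
  subst hij
  have h2 := (h.1 i).2
  rw [eval_monicPoly_eq] at h2
  refine ⟨rfl, Function.iterate_injOn_Iio_minimalPeriod (f := monicStep a) (x := β i) ?_ ?_ hst⟩
  · rwa [Set.mem_Iio, h2]
  · rwa [Set.mem_Iio, h2]

/-- As `k < n`, the factor `k/n - 1` cancels, and a relation on the window `e ≤ k < e + m` says that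
`m` consecutive weighted power sums of the distinct orbit points vanish. With at most `m` points,
Vandermonde kills the weights. The shift `e` allows skipping the low coordinates. -/
theorem coeff_eq_zero_of_sum_multiplierGrad_zero (hn : 2 ≤ n) (hr : ∀ i, 0 < r i)
    {β : Fin ℓ → ℂ} (h : IsPeriodicTuple (monicPoly (0 : Fin n → ℂ)) r β) {c : Fin ℓ → ℂ}
    {e m : ℕ} (hem : e + m ≤ n) (hm : ∑ i : {i // β i ≠ 0}, r i ≤ m)
    (hc : ∀ k : Fin n, e ≤ k → (k : ℕ) < e + m →
      ∑ i : {i // β i ≠ 0}, c i * multiplierGrad (r i) 0 (β i) k = 0) :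
    ∀ i, β i ≠ 0 → c i = 0 := by
  have hper := iterate_eq_of_isPeriodicTuple h
  have hn0 : (n : ℂ) ≠ 0 := by exact_mod_cast (by omega : n ≠ 0)
  have hpow : ∀ (j : ℕ) (z : ℂ), z ≠ 0 → (monicStep (0 : Fin n → ℂ))^[j] z ≠ 0 := by
    intro j z hz
    induction j with
    | zero => exact hz
    | succ j ih =>
      rw [Function.iterate_succ_apply', monicStep_zero]
      exact pow_ne_zero n ih
  have hC : ∀ i, β i ≠ 0 → iterDiff (0 : Fin n → ℂ) (r i) (β i) (β i) ≠ 0 := by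
    intro i hi h0
    have := iterDiff_zero_mul (by omega : 1 ≤ n) (r i) (β i)
    rw [h0, zero_mul, hper] at this
    exact mul_ne_zero (pow_ne_zero _ hn0) hi this.symm
  let p : (Σ i : {i // β i ≠ 0}, Fin (r i)) → ℂ := fun x =>
    (monicStep (0 : Fin n → ℂ))^[x.2] (β x.1)
  let w : (Σ i : {i // β i ≠ 0}, Fin (r i)) → ℂ := fun x =>
    c x.1 * iterDiff (0 : Fin n → ℂ) (r x.1) (β x.1) (β x.1) / p x ^ n * p x ^ e
  have hp : Function.Injective p := by
    rintro ⟨⟨i, hi⟩, s⟩ ⟨⟨j, hj⟩, t⟩ hst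
    obtain ⟨rfl, hst'⟩ := injective_orbits_of_isPeriodicTuple h s.2 t.2 hst
    rw [Fin.ext hst']
  have hw : w = 0 := by
    refine eq_zero_of_sum_mul_pow_eq_zero hp (m := m) (by simpa using hm) fun k hk => ?_
    have hkn : ((e + k : ℕ) : ℂ) / n - 1 ≠ 0 := by
      rw [sub_ne_zero, ne_eq, div_eq_one_iff_eq hn0]
      exact_mod_cast (by omega : e + k ≠ n)
    have h1 := hc ⟨e + k, by omega⟩ (Nat.le_add_right _ _) (by simpa using hk)
    refine (mul_eq_zero.1 (Eq.trans ?_ h1)).resolve_left hkn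
    rw [Fintype.sum_sigma, Finset.mul_sum]
    refine Finset.sum_congr rfl fun i _ => ?_
    rw [multiplierGrad_zero_of_ne_zero hn (zero_mem_Znr hn (hr i)) (hper i) i.2,
      ← Fin.sum_univ_eq_sum_range (fun j => (monicStep (0 : Fin n → ℂ))^[j] (β i) ^ (e + k) /
        (monicStep (0 : Fin n → ℂ))^[j] (β i) ^ n), Finset.mul_sum, Finset.mul_sum, Finset.mul_sum,
      Finset.mul_sum]
    refine Finset.sum_congr rfl fun j _ => ?_
    simp only [w, p, pow_add]
    ring
  intro i hi
  have h0 := congrFun hw ⟨⟨i, hi⟩, ⟨0, hr i⟩⟩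
  have hpi : p ⟨⟨i, hi⟩, ⟨0, hr i⟩⟩ = β i := rfl
  simp only [w, hpi, Pi.zero_apply] at h0
  simpa [hi, hC i hi] using h0

theorem zero_mem_Zset (hn : 2 ≤ n) (hr : ∀ i, 0 < r i) : (0 : Fin n → ℂ) ∈ Zset n r :=
  Set.mem_iInter.2 fun i => zero_mem_Znr hn (hr i)

theorem zero_mem_Z0set (hn : 3 ≤ n) (hr : ∀ i, 0 < r i) (hsum : ∑ i, r i ≤ n)
    (hsum' : (∃ j, r j = 1) → ∑ i, r i < n) : (0 : Fin n → ℂ) ∈ Z0set n r := by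
  refine ⟨zero_mem_Zset (by omega) hr, fun β h => ?_⟩
  rw [Fintype.linearIndependent_iff]
  intro c hc
  have hck : ∀ k : Fin n, ∑ i, c i * multiplierGrad (r i) 0 (β i) k = 0 := by
    intro k
    simpa using congrFun hc k
  have hsplit : ∀ f : Fin ℓ → ℂ, (∀ i, β i = 0 → f i = 0) →
      ∑ i : {i // β i ≠ 0}, f i = ∑ i, f i := by
    intro f hf
    rw [← Fintype.sum_subtype_add_sum_subtype (fun i => β i ≠ 0) f,
      Fintype.sum_eq_zero (fun i : {i // ¬ β i ≠ 0} => f i) fun i => hf i (not_not.1 i.2),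
      add_zero]
  by_cases hz : ∃ i, β i = 0
  · obtain ⟨i₀, hi₀⟩ := hz
    have hr₀ : ∀ i, β i = 0 → r i = 1 := by
      intro i hi
      rw [← (h.1 i).2, Function.minimalPeriod_eq_one_iff_isFixedPt, hi]
      simp only [Function.IsFixedPt, eval_monicPoly, monicStep_zero]
      exact zero_pow (by omega)
    have huniq : ∀ i, β i = 0 → i = i₀ := by
      intro i hi
      by_contra hne
      exact h.2 hne (by rw [hi, hi₀])
    have hlt := hsum' ⟨i₀, hr₀ i₀ hi₀⟩
    have hcard : ∑ i : {i // β i ≠ 0}, r i ≤ n - 2 := by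
      have h1 := Fintype.sum_subtype_add_sum_subtype (fun i => β i ≠ 0) r
      have h2 : 1 ≤ ∑ i : {i // ¬ β i ≠ 0}, r i :=
        (hr i₀).trans_le (Finset.single_le_sum (f := fun i : {i // ¬ β i ≠ 0} => r i)
          (fun _ _ => Nat.zero_le _) (Finset.mem_univ ⟨i₀, not_not.2 hi₀⟩))
      omega
    -- The gradient `e_1` of the fixed point `0` is invisible on the window `2 ≤ k < n`. Its `n - 2`
    -- exponents suffice because `∑ r_i ≤ n - 1` and the fixed point itself uses one unit.
    have hnz := coeff_eq_zero_of_sum_multiplierGrad_zero (by omega) hr h (c := c) (e := 2)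
      (m := n - 2) (by omega) hcard fun k hk _ => by
        rw [hsplit (fun i => c i * multiplierGrad (r i) 0 (β i) k), hck]
        intro i hi
        rw [hr₀ i hi, hi, multiplierGrad_zero_zero hn, if_neg (by omega), mul_zero]
    intro i
    by_cases hi : β i = 0
    · obtain rfl := huniq i hi
      have h1 := hck ⟨1, by omega⟩
      rw [Finset.sum_eq_single i, hr₀ i hi, hi, multiplierGrad_zero_zero hn] at h1
      · simpa using h1
      · intro j _ hj
        rw [hnz j fun h0 => hj (huniq j h0), zero_mul]
      · simp
    · exact hnz i hi
  · push Not at hz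
    have hcard : ∑ i : {i // β i ≠ 0}, r i ≤ n := by
      have h1 := Fintype.sum_subtype_add_sum_subtype (fun i => β i ≠ 0) r
      omega
    exact fun i => coeff_eq_zero_of_sum_multiplierGrad_zero (by omega) hr h (c := c) (e := 0)
      (m := n) (by omega) hcard (fun k _ _ => by
        rw [hsplit (fun i => c i * multiplierGrad (r i) 0 (β i) k)
          fun i hi => absurd hi (hz i), hck]) i (hz i)

end PowerIndependence

theorem corollary1p3 (n ℓ : ℕ) (r : Fin ℓ → ℕ) (hn : 3 ≤ n) (hℓ : 0 < ℓ) (hr : ∀ i, 0 < r i)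
    (hsum : ∑ i, r i ≤ n) (hsum' : (∃ j, r j = 1) → ∑ i, r i < n) :
    -- `Z⁰` is a Zariski-open subset of `Z`, and of the whole space
    Z0set n r ⊆ Zset n r ∧
    (∃ U, IsOpen[zariskiTopology n] U ∧ Z0set n r = Zset n r ∩ U) ∧
    IsOpen[zariskiTopology n] (Z0set n r) ∧
    -- `Z⁰` is dense in `Z`, in the Zariski topology and in the complex topology
    Zset n r ⊆ closure[zariskiTopology n] (Z0set n r) ∧
    Zset n r ⊆ closure (Z0set n r) ∧
    -- `Z⁰` contains the polynomial `x ^ n`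
    (∃ a ∈ Z0set n r, monicPoly a = X ^ n) ∧
    -- `Z⁰` is the set where every multiplier map is holomorphic of rank `ℓ`
    ∀ a ∈ Zset n r, a ∈ Z0set n r ↔
      ∀ β : Fin ℓ → ℂ, IsPeriodicTuple (monicPoly a) r β →
        AnalyticAt ℂ (multiplierMap r a β) a ∧
          Module.finrank ℂ (fderiv ℂ (multiplierMap r a β) a).range = ℓ := by
  have hn2 : 2 ≤ n := by omega
  have hmem := zero_mem_Z0set hn hr hsum hsum'
  have hU := exists_isOpen_zariski_Z0set hn2 hr
  have hopen : IsOpen[zariskiTopology n] (Z0set n r) := by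
    obtain ⟨U, hUo, hUe⟩ := hU
    rw [hUe]
    exact (zariskiTopology n).isOpen_inter _ _ (isOpen_zariski_Zset hn2 hr) hUo
  have hdense : Zset n r ⊆ closure (Z0set n r) := fun a _ =>
    dense_of_isOpen_zariski hopen ⟨0, hmem⟩ a
  refine ⟨fun a ha => ha.1, hU, hopen, hdense.trans (closure_subset_closure_zariski _), hdense,
    ⟨0, hmem, monicPoly_zero⟩, fun a ha => ?_⟩
  have h : a ∈ Z0set n r ↔ ∀ β : Fin ℓ → ℂ, IsPeriodicTuple (monicPoly a) r β →
      LinearIndependent ℂ fun i => multiplierGrad (r i) a (β i) := and_iff_right ha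
  rw [h]
  refine forall_congr' fun β => forall_congr' fun hβ => ?_
  have hper := iterate_eq_of_isPeriodicTuple hβ
  rw [finrank_range_fderiv_multiplierMap_iff ha hper]
  exact (and_iff_right (analyticAt_multiplierMap ha hper)).symm
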